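/- Let $0\le\alpha<1$ and let $n,d$ be integers with $2\le d\le n-1$. All digraphs are finite and simple (no loops, no multiple arcs). For a digraph $G$ let $A(G)$ be its adjacency matrix ($a_{uv}=1$ if $(u,v)$ is an arc, and $0$ otherwise), $D(G)$ the diagonal matrix of the outdegrees, and $A_\alpha(G)=\alpha D(G)+(1-\alpha)A(G)$. Let $\lambda_\alpha(G)$ be the spectral radius of $A_\alpha(G)$, that is, the largest modulus of its (complex) eigenvalues. The clique number of $G$ is the largest number of vertices in a set any two distinct vertices $u,v$ of which are joined by both arcs $(u,v)$ and $(v,u)$. Let $B_{n,d}$ be the digraph with vertices $v_1,\dots,v_n$ in which the $d$ vertices $v_1,v_{n-d+2},v_{n-d+3},\dots,v_n$ induce a complete digraph (both arcs between any two distinct vertices), and whose only other arcs are those of the directed path $v_1v_2\cdots v_{n-d+2}$, i.e. $(v_i,v_{i+1})$ for $1\le i\le n-d+1$. Then every strongly connected digraph $G$ on $n$ vertices with clique number $d$ satisfies $$\lambda_\alpha(G)\ \ge\ \lambda_\alpha(B_{n,d}),$$ with equality if and only if $G\cong B_{n,d}$. -/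

import Mathlib

namespace AAlpha

/-- A digraph is simple if it has no loops (multiple arcs are excluded by the type `Digraph`). -/
def IsSimple {V : Type*} (G : Digraph V) : Prop :=
  ∀ v, ¬ G.Adj v v

/-- From every vertex there is a directed path to every vertex. -/
def IsStronglyConnected {V : Type*} (G : Digraph V) : Prop :=
  ∀ u v, Relation.ReflTransGen G.Adj u v

/-- `S` induces a complete subdigraph of `G`: for any two distinct vertices of `S` both arcs
between them are present. -/
def IsClique {V : Type*} (G : Digraph V) (S : Finset V) : Prop :=
  (S : Set V).Pairwise G.Adj

/-- The clique number of a finite digraph: the maximum number of vertices of a clique. -/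
noncomputable def cliqueNumber {V : Type*} (G : Digraph V) : ℕ :=
  sSup {k | ∃ S : Finset V, IsClique G S ∧ S.card = k}

open Classical in
/-- The adjacency matrix `A(G)`. -/
noncomputable def adjMatrix {V : Type*} (G : Digraph V) : Matrix V V ℝ :=
  Matrix.of fun u v => if G.Adj u v then 1 else 0

open Classical in
/-- The outdegree of a vertex. -/
noncomputable def outDegree {V : Type*} [Fintype V] (G : Digraph V) (u : V) : ℕ :=
  (Finset.univ.filter fun v => G.Adj u v).card

/-- The matrix `A_α(G) = α D(G) + (1 - α) A(G)`, where `D(G)` is the diagonal matrix of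
outdegrees. -/
noncomputable def aMatrix {V : Type*} [Fintype V] [DecidableEq V] (α : ℝ) (G : Digraph V) :
    Matrix V V ℝ :=
  α • Matrix.diagonal (fun u => (outDegree G u : ℝ)) + (1 - α) • adjMatrix G

/-- The `A_α` spectral radius `λ_α(G)`: the largest modulus of the complex eigenvalues of
`A_α(G)`. -/
noncomputable def aRadius {V : Type*} [Fintype V] [DecidableEq V] (α : ℝ) (G : Digraph V) : ℝ :=
  (spectralRadius ℂ ((aMatrix α G).map (fun x : ℝ => (x : ℂ)))).toReal

/-- The digraph `B_{n,d}` for `2 ≤ d ≤ n - 1`, with the vertices `v_1, …, v_n` numbered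
`0, …, n - 1`. The vertices `v_1` and `v_{n-d+2}, …, v_n` form a complete digraph on `d` vertices,
and the remaining arcs are those of the directed path `v_1 v_2 … v_{n-d+2}`. -/
def digraphB (n d : ℕ) : Digraph (Fin n) where
  Adj i j :=
    (i ≠ j ∧ (i.val = 0 ∨ n + 1 ≤ i.val + d) ∧ (j.val = 0 ∨ n + 1 ≤ j.val + d)) ∨
      (i.val + 1 = j.val ∧ j.val + d ≤ n + 1)

end AAlpha

namespace AAlpha

open Matrix Filter Topology

/-! ### Collatz–Wielandt bounds for nonnegative matrices. -/

section Spectral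

attribute [local instance] Matrix.linftyOpNormedRing Matrix.linftyOpNormedAlgebra

variable {V : Type*} [Fintype V]

/-! The proof is a Collatz–Wielandt comparison: if A is nonnegative, y > 0 and A y ≥ μ y, then ρ(A)
≥ μ, strictly when A is irreducible and some row is strict. In G take a clique K on d vertices, an
arc from some u ∈ K to some w₀ ∉ K, and a shortest walk from w₀ back to K; it has at most m = n - d
vertices outside K. Let y be b at u, 1 on the rest of K and t^δ outside K, where δ is the distance
to K. `exists_weights` chooses μ, b, t so that the same recipe on B_{n,d} gives an eigenvector for
μ. On G, a shorter ear, a return to u, or a further arc can only raise a row of A_α y, because t < 1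
< b and every arc contributes a positive term. Hence μ ≤ λ_α(G) (`IsEar.le_aRadius`), while
`aRadius_digraphB_le` gives λ_α(B_{n,d}) ≤ μ. If λ_α(G) ≤ μ, `lt_realRadius` rules out every surplus
(`IsEar.eq_of_aRadius_le`): G has only the chosen arcs, the ear has m inner vertices, and no vertex
outside K is sent to u. Each distance 1, …, m then occurs exactly once outside K, and
`IsEar.nonempty_iso` numbers the vertices accordingly. -/

theorem map_ofReal_mulVec (A : Matrix V V ℝ) (y : V → ℝ) (i : V) :
    ((A.map (fun x : ℝ => (x : ℂ))) *ᵥ (fun j => (y j : ℂ))) i = ((A *ᵥ y) i : ℂ) := by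
  simp [Matrix.mulVec, dotProduct]

theorem mulVec_le_mulVec_of_nonneg {A : Matrix V V ℝ} (hA : ∀ i j, 0 ≤ A i j) {x y : V → ℝ}
    (h : ∀ i, x i ≤ y i) (i : V) : (A *ᵥ x) i ≤ (A *ᵥ y) i :=
  Finset.sum_le_sum fun j _ => mul_le_mul_of_nonneg_left (h j) (hA i j)

variable [DecidableEq V]

/-- The spectral radius, over the complex numbers, of a real square matrix. -/
noncomputable def realRadius (A : Matrix V V ℝ) : ℝ :=
  (spectralRadius ℂ (A.map (fun x : ℝ => (x : ℂ)))).toReal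

theorem map_ofReal_pow (A : Matrix V V ℝ) (k : ℕ) :
    (A.map (fun x : ℝ => (x : ℂ))) ^ k = (A ^ k).map (fun x : ℝ => (x : ℂ)) :=
  (Matrix.map_pow A Complex.ofRealHom k).symm

theorem spectralRadius_ne_top [Nonempty V] (A : Matrix V V ℂ) : spectralRadius ℂ A ≠ ⊤ := by
  have : CompleteSpace (Matrix V V ℂ) := FiniteDimensional.complete ℂ _
  exact ne_top_of_le_ne_top ENNReal.coe_ne_top (spectrum.spectralRadius_le_nnnorm A)

theorem pow_mul_le_pow_mulVec {A : Matrix V V ℝ} (hA : ∀ i j, 0 ≤ A i j) {y : V → ℝ} {μ : ℝ}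
    (hμ : 0 ≤ μ) (h : ∀ i, μ * y i ≤ (A *ᵥ y) i) (k : ℕ) (i : V) :
    μ ^ k * y i ≤ ((A ^ k) *ᵥ y) i := by
  induction k generalizing i with
  | zero => simp
  | succ k ih =>
    have h1 := mulVec_le_mulVec_of_nonneg hA ih i
    rw [mulVec_mulVec, ← pow_succ'] at h1
    have h2 : (A *ᵥ fun i => μ ^ k * y i) i = μ ^ k * (A *ᵥ y) i := by
      have : (fun i => μ ^ k * y i) = μ ^ k • y := rfl
      rw [this, mulVec_smul]; rfl
    rw [h2] at h1
    refine le_trans ?_ h1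
    rw [pow_succ, mul_assoc]
    exact mul_le_mul_of_nonneg_left (h i) (pow_nonneg hμ k)

/-- Collatz–Wielandt lower bound. -/
theorem le_realRadius [Nonempty V] {A : Matrix V V ℝ} (hA : ∀ i j, 0 ≤ A i j) {y : V → ℝ}
    (hy : ∀ i, 0 < y i) {μ : ℝ} (hμ : 0 ≤ μ) (h : ∀ i, μ * y i ≤ (A *ᵥ y) i) :
    μ ≤ realRadius A := by
  by_contra! hlt
  obtain ⟨r, hr1, hr2⟩ := exists_between hlt
  have hr0 : 0 < r := lt_of_le_of_lt ENNReal.toReal_nonneg hr1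
  have : CompleteSpace (Matrix V V ℂ) := FiniteDimensional.complete ℂ _
  set B : Matrix V V ℂ := A.map (fun x : ℝ => (x : ℂ)) with hB
  have hs : spectralRadius ℂ B < ENNReal.ofReal r :=
    (ENNReal.lt_ofReal_iff_toReal_lt (spectralRadius_ne_top B)).2 hr1
  -- Gelfand's formula: eventually ‖B ^ k‖ < r ^ k with r < μ, against growth at least μ ^ k.
  have hev := (spectrum.pow_norm_pow_one_div_tendsto_nhds_spectralRadius B).eventually_lt_const hs
  obtain ⟨i⟩ := ‹Nonempty V›
  have hbound : ∀ k : ℕ, μ ^ k * y i ≤ ‖B ^ k‖ * ‖fun j => (y j : ℂ)‖ := fun k => by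
    refine le_trans (pow_mul_le_pow_mulVec hA hμ h k i) ?_
    refine le_trans ?_ (Matrix.linfty_opNorm_mulVec (B ^ k) _)
    refine le_trans ?_ (norm_le_pi_norm _ i)
    rw [hB, map_ofReal_pow, map_ofReal_mulVec, Complex.norm_real]
    exact le_abs_self _
  set C := ‖fun j => (y j : ℂ)‖
  have hμ0 : 0 < μ := hr0.trans hr2
  have hlim : Tendsto (fun k : ℕ => (r / μ) ^ k * C) atTop (𝓝 (0 * C)) :=
    (tendsto_pow_atTop_nhds_zero_of_lt_one (by positivity) ((div_lt_one hμ0).2 hr2)).mul_const C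
  rw [zero_mul] at hlim
  obtain ⟨k, hk1, hk2, hk3⟩ :=
    (hev.and ((hlim.eventually_lt_const (hy i)).and (eventually_gt_atTop 0))).exists
  have hk4 : ‖B ^ k‖ ≤ r ^ k := by
    have h1 := (ENNReal.ofReal_lt_ofReal_iff hr0).1 hk1
    have h2 := pow_le_pow_left₀ (Real.rpow_nonneg (norm_nonneg (B ^ k)) _) h1.le k
    rwa [one_div, Real.rpow_inv_natCast_pow (norm_nonneg _) hk3.ne'] at h2
  have h5 : μ ^ k * y i ≤ r ^ k * C :=
    (hbound k).trans (mul_le_mul_of_nonneg_right hk4 (norm_nonneg _))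
  rw [div_pow, div_mul_eq_mul_div, div_lt_iff₀ (pow_pos hμ0 k)] at hk2
  linarith

/-- Collatz–Wielandt upper bound. -/
theorem realRadius_le {A : Matrix V V ℝ} (hA : ∀ i j, 0 ≤ A i j) {y : V → ℝ}
    (hy : ∀ i, 0 < y i) {μ : ℝ} (hμ : 0 ≤ μ) (h : ∀ i, (A *ᵥ y) i ≤ μ * y i) :
    realRadius A ≤ μ := by
  refine ENNReal.toReal_le_of_le_ofReal hμ (iSup₂_le fun z hz => ?_)
  rw [← Matrix.spectrum_toLin', ← Module.End.hasEigenvalue_iff_mem_spectrum] at hz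
  obtain ⟨v, hv⟩ := hz.exists_hasEigenvector
  have hv1 : A.map (fun x : ℝ => (x : ℂ)) *ᵥ v = z • v := by
    simpa using hv.apply_eq_smul
  obtain ⟨j, hj⟩ := Function.ne_iff.1 hv.2
  -- The eigenvalue equation is read in the row where |v| is largest relative to y.
  obtain ⟨i, -, hi⟩ := Finset.exists_max_image Finset.univ (fun i => ‖v i‖ / y i) ⟨j, by simp⟩
  have hpos : 0 < ‖v i‖ / y i :=
    lt_of_lt_of_le (div_pos (norm_pos_iff.2 hj) (hy j)) (hi j (Finset.mem_univ _))
  set q := ‖v i‖ / y i with hq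
  have hvi : ‖v i‖ = q * y i := by rw [hq, div_mul_cancel₀ _ (hy i).ne']
  have hle : ∀ l, ‖v l‖ ≤ q * y l := fun l => (div_le_iff₀ (hy l)).1 (hi l (Finset.mem_univ _))
  have key : ‖z‖ * (q * y i) ≤ q * (μ * y i) := by
    rw [← hvi, ← norm_mul]
    have : z * v i = ∑ l, (A i l : ℂ) * v l := by
      have := congrFun hv1 i
      simpa [Matrix.mulVec, dotProduct] using this.symm
    rw [this]
    calc ‖∑ l, (A i l : ℂ) * v l‖ ≤ ∑ l, ‖(A i l : ℂ) * v l‖ := norm_sum_le _ _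
      _ ≤ ∑ l, A i l * (q * y l) := by
          refine Finset.sum_le_sum fun l _ => ?_
          rw [norm_mul, Complex.norm_real, Real.norm_eq_abs, abs_of_nonneg (hA i l)]
          exact mul_le_mul_of_nonneg_left (hle l) (hA i l)
      _ = q * (A *ᵥ y) i := by
          simp only [Matrix.mulVec, dotProduct, Finset.mul_sum]
          exact Finset.sum_congr rfl fun l _ => by ring
      _ ≤ q * (μ * y i) := mul_le_mul_of_nonneg_left (h i) hpos.le
  have hz : ‖z‖ ≤ μ := by
    have : 0 < q * y i := mul_pos hpos (hy i)
    refine le_of_mul_le_mul_right ?_ this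
    linarith
  change ‖z‖ₑ ≤ _
  rw [← ofReal_norm z]
  exact ENNReal.ofReal_le_ofReal hz

/-- The Collatz–Wielandt lower bound is strict unless it is attained by an eigenvector, provided
every vertex has a walk to every other vertex along positive entries. -/
theorem lt_realRadius {A : Matrix V V ℝ} (hA : ∀ i j, 0 ≤ A i j)
    {R : V → V → Prop} (hR : ∀ i j, R i j → 0 < A i j)
    (hconn : ∀ i j, Relation.ReflTransGen R i j) {y : V → ℝ}
    (hy : ∀ i, 0 < y i) {μ : ℝ} (hμ : 0 ≤ μ) (h : ∀ i, μ * y i ≤ (A *ᵥ y) i)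
    {s : V} (hs : μ * y s < (A *ᵥ y) s) : μ < realRadius A := by
  have : Nonempty V := ⟨s⟩
  set z : V → ℝ := fun i => (A *ᵥ y) i - μ * y i with hz
  have hz' : z = A *ᵥ y - μ • y := rfl
  have hAk : ∀ (x : V → ℝ), (∀ i, 0 ≤ x i) → ∀ k i, 0 ≤ ((A ^ k) *ᵥ x) i := by
    intro x hx k
    induction k with
    | zero => simpa using hx
    | succ k ih =>
      intro i
      rw [pow_succ', ← mulVec_mulVec]
      exact Finset.sum_nonneg fun j _ => mul_nonneg (hA i j) (ih j)
  have hz0 : ∀ i, 0 ≤ z i := fun i => sub_nonneg.2 (h i)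
  have hpos : ∀ i, ∃ k, 0 < ((A ^ k) *ᵥ z) i := by
    intro i
    induction hconn i s using Relation.ReflTransGen.head_induction_on with
    | refl => exact ⟨0, by simpa [hz] using hs⟩
    | @head a b hab _ ih =>
      obtain ⟨k, hk⟩ := ih
      refine ⟨k + 1, ?_⟩
      rw [pow_succ', ← mulVec_mulVec]
      exact Finset.sum_pos' (fun j _ => mul_nonneg (hA a j) (hAk z hz0 k j))
        ⟨b, Finset.mem_univ _, mul_pos (hR a b hab) hk⟩
  choose f hf using hpos
  -- Summing the powers A ^ k for k < N spreads the surplus z to every vertex, since N exceeds every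
  -- `f i`.
  set N := Finset.univ.sup f + 1 with hN
  set w : (V → ℝ) → V → ℝ := fun x => ∑ k ∈ Finset.range N, (A ^ k) *ᵥ x with hw
  have hwz : ∀ i, 0 < w z i := fun i => by
    rw [hw]
    simp only [Finset.sum_apply]
    exact Finset.sum_pos' (fun k _ => hAk z hz0 k i) ⟨f i, by
      rw [Finset.mem_range, hN, Nat.lt_succ_iff]
      exact Finset.le_sup (f := f) (Finset.mem_univ i), hf i⟩
  have hwy : ∀ i, 0 < w y i := fun i => by
    rw [hw]
    simp only [Finset.sum_apply]
    exact Finset.sum_pos' (fun k _ => hAk y (fun j => (hy j).le) k i)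
      ⟨0, by simp [hN], by simpa using hy i⟩
  -- The sum of powers commutes with A, so the new vector has surplus `w z`, positive in every row.
  have hwA : A *ᵥ w y = w z + μ • w y := by
    simp only [hw, hz', mulVec_sub, Finset.sum_sub_distrib, mulVec_smul, Finset.smul_sum,
      sub_add_cancel, mulVec_sum, mulVec_mulVec, ← pow_succ, ← pow_succ']
  obtain ⟨i, -, hi⟩ := Finset.exists_min_image Finset.univ (fun i => w z i / w y i)
    Finset.univ_nonempty
  set ε := w z i / w y i with hε
  have hε0 : 0 < ε := div_pos (hwz i) (hwy i)
  have hle : μ + ε ≤ realRadius A := by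
    refine le_realRadius hA hwy (by positivity) fun j => ?_
    have h1 := (le_div_iff₀ (hwy j)).1 (hi j (Finset.mem_univ _))
    rw [hwA]
    simp only [Pi.add_apply, Pi.smul_apply, smul_eq_mul]
    linarith
  linarith

end Spectral

end AAlpha

/-! ### The eigenvector equations and the test vector on a clique with an ear. -/

namespace AAlpha

open Matrix

/-- The spectral radius and the entries of the eigenvector of the digraph consisting of a complete
digraph on `d` vertices and an ear with `m` inner vertices. -/
theorem exists_weights {α : ℝ} (hα0 : 0 ≤ α) (hα1 : α < 1) {d : ℕ} (hd : 2 ≤ d) (m : ℕ) :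
    ∃ μ b t : ℝ, 0 ≤ μ ∧ 1 < b ∧ 0 < t ∧ t < 1 ∧
      ((d : ℝ) - 1) * α + (1 - α) * (d - 2 + b) = μ ∧
      ((d : ℝ) - 1) * (α * b + (1 - α)) + (α * b + (1 - α) * t ^ m) = μ * b ∧
      α * t + (1 - α) = μ * t := by
  have hd' : (2 : ℝ) ≤ d := by exact_mod_cast hd
  have hα : 0 < 1 - α := by linarith
  -- The equation at the root u, multiplied by 1 - α, after b and t are eliminated through the other
  -- two.
  set F : ℝ → ℝ := fun x => (x - α * d) * (x - α - d + 2) - (1 - α) ^ 2 * (d - 1)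
    - (1 - α) ^ 2 * ((1 - α) / (x - α)) ^ m with hF
  have hcont : ContinuousOn F (Set.Icc ((d : ℝ) - 1) d) := by
    have : ContinuousOn (fun x : ℝ => (1 - α) / (x - α)) (Set.Icc ((d : ℝ) - 1) d) :=
      continuousOn_const.div (by fun_prop) fun x hx => by
        have := hx.1
        intro h0
        linarith
    exact ContinuousOn.sub (by fun_prop) (continuousOn_const.mul (this.pow m))
  have hF1 : F (d - 1) < 0 := by
    have h1 : 0 < ((1 - α) / ((d : ℝ) - 1 - α)) ^ m :=
      pow_pos (div_pos hα (by linarith)) m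
    have h2 : 0 < (1 - α) ^ 2 * ((1 - α) / ((d : ℝ) - 1 - α)) ^ m := by positivity
    have h3 : F (d - 1) = - ((1 - α) * α) - (1 - α) ^ 2 * ((1 - α) / ((d : ℝ) - 1 - α)) ^ m := by
      simp only [hF]; ring
    have : 0 ≤ (1 - α) * α := by positivity
    linarith
  have hF2 : 0 < F d := by
    have h0 : 0 < (1 - α) / ((d : ℝ) - α) := div_pos hα (by linarith)
    have h1 : ((1 - α) / ((d : ℝ) - α)) ^ m ≤ 1 :=
      pow_le_one₀ h0.le ((div_le_one (by linarith)).2 (by linarith))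
    have h2 : (1 - α) ^ 2 * ((1 - α) / ((d : ℝ) - α)) ^ m ≤ (1 - α) ^ 2 :=
      mul_le_of_le_one_right (by positivity) h1
    have h3 : F d = (1 - α) * d + (1 - α) ^ 2
        - (1 - α) ^ 2 * ((1 - α) / ((d : ℝ) - α)) ^ m := by
      simp only [hF]; ring
    have : 0 < (1 - α) * d := by positivity
    linarith
  obtain ⟨μ, ⟨hμ1, hμ2⟩, hμ⟩ := intermediate_value_Icc (by linarith) hcont ⟨hF1.le, hF2.le⟩
  -- Strictness here is what yields b > 1; with d ≥ 2 it also yields t < 1.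
  have hμ3 : (d : ℝ) - 1 < μ := lt_of_le_of_ne hμ1 fun h => by rw [h, hμ] at hF1; exact hF1.false
  refine ⟨μ, (μ - α - d + 2) / (1 - α), (1 - α) / (μ - α), by linarith,
    (one_lt_div hα).2 (by linarith), div_pos hα (by linarith),
    (div_lt_one (by linarith)).2 (by linarith), ?_, ?_, ?_⟩
  · field_simp
    ring
  · have h1 : F μ = 0 := hμ
    simp only [hF] at h1
    generalize ((1 - α) / (μ - α)) ^ m = s at *
    field_simp
    linear_combination -h1
  · have : μ - α ≠ 0 := by linarith
    field_simp
    ring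

section Ear

variable {V : Type*}

/-- A complete set `K` with a shortest walk of at most `m` inner vertices leaving it at `u`:
`δ` is the distance to `K`, and `next` is the successor of `u` and of the vertices outside `K`. -/
structure IsEar (K : Finset V) (u : V) (next : V → V) (δ : V → ℕ) (m : ℕ) : Prop where
  mem : u ∈ K
  next_notMem : next u ∉ K
  dist_eq_zero : ∀ w, δ w = 0 ↔ w ∈ K
  dist_next : ∀ w ∉ K, δ (next w) + 1 = δ w
  dist_le : δ (next u) ≤ m

variable [DecidableEq V]

/-- The outneighbours in the digraph consisting of a complete digraph on `K` and the arcs given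
by `next` at `u` and outside `K`. -/
def earTargets (K : Finset V) (u : V) (next : V → V) (w : V) : Finset V :=
  if w ∈ K then if w = u then insert (next u) (K.erase u) else K.erase w else {next w}

/-- The test vector: `b` at `u`, and powers of `t` elsewhere. -/
def earWeight (b t : ℝ) (u : V) (δ : V → ℕ) (w : V) : ℝ :=
  if w = u then b else t ^ δ w

variable {K : Finset V} {u : V} {next : V → V} {δ : V → ℕ} {m : ℕ} {α μ b t : ℝ}

theorem earWeight_pos (hb : 1 < b) (ht : 0 < t) (w : V) : 0 < earWeight b t u δ w := by
  unfold earWeight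
  split_ifs
  · linarith
  · positivity

theorem IsEar.sum_clique (h : IsEar K u next δ m) {w : V} (hw : w ∈ K) :
    ∑ v ∈ K.erase w, (α * earWeight b t u δ w + (1 - α) * earWeight b t u δ v) =
      ((K.card : ℝ) - 1) * (α * earWeight b t u δ w) +
        (1 - α) * (K.card - 1 + b - earWeight b t u δ w) := by
  have h1 : ∑ v ∈ K.erase u, earWeight b t u δ v = (K.card : ℝ) - 1 := by
    rw [Finset.sum_congr rfl (g := fun _ => (1 : ℝ)) fun v hv => ?_]
    · simp [Finset.cast_card_erase_of_mem h.mem]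
    · obtain ⟨h1, h2⟩ := Finset.mem_erase.1 hv
      simp [earWeight, h1, (h.dist_eq_zero v).2 h2]
  have h2 := Finset.add_sum_erase K (earWeight b t u δ) h.mem
  have h3 := Finset.add_sum_erase K (earWeight b t u δ) hw
  have h4 : earWeight b t u δ u = b := by simp [earWeight]
  rw [Finset.sum_add_distrib, Finset.sum_const, nsmul_eq_mul, ← Finset.mul_sum,
    Finset.cast_card_erase_of_mem hw]
  linear_combination (1 - α) * (h3 - h2 + h1 + h4)

theorem IsEar.sum_of_mem_ne (h : IsEar K u next δ m)
    (h1 : ((K.card : ℝ) - 1) * α + (1 - α) * (K.card - 2 + b) = μ)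
    {w : V} (hw : w ∈ K) (hwu : w ≠ u) :
    ∑ v ∈ earTargets K u next w, (α * earWeight b t u δ w + (1 - α) * earWeight b t u δ v) =
      μ * earWeight b t u δ w := by
  have h2 : earWeight b t u δ w = 1 := by simp [earWeight, hwu, (h.dist_eq_zero w).2 hw]
  rw [earTargets, if_pos hw, if_neg hwu, h.sum_clique hw, h2, ← h1]
  ring

/-- The surplus measures how much shorter than m the ear is. -/
theorem IsEar.sum_root (h : IsEar K u next δ m)
    (h2 : ((K.card : ℝ) - 1) * (α * b + (1 - α)) + (α * b + (1 - α) * t ^ m) = μ * b) :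
    ∑ v ∈ earTargets K u next u, (α * earWeight b t u δ u + (1 - α) * earWeight b t u δ v) =
      μ * earWeight b t u δ u + (1 - α) * (t ^ δ (next u) - t ^ m) := by
  have h3 : earWeight b t u δ u = b := by simp [earWeight]
  have h4 : next u ≠ u := fun h' => h.next_notMem (h'.symm ▸ h.mem)
  have h5 : earWeight b t u δ (next u) = t ^ δ (next u) := by simp [earWeight, h4]
  rw [earTargets, if_pos h.mem, if_pos rfl,
    Finset.sum_insert fun h' => h.next_notMem (Finset.mem_of_mem_erase h'), h.sum_clique h.mem,
    h3, h5, ← h2]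
  ring

/-- One step closer to K divides the weight by t, except that a step into u meets b instead of 1;
this is the surplus. -/
theorem IsEar.sum_of_notMem (h : IsEar K u next δ m) (h3 : α * t + (1 - α) = μ * t)
    {w : V} (hw : w ∉ K) :
    ∑ v ∈ earTargets K u next w, (α * earWeight b t u δ w + (1 - α) * earWeight b t u δ v) =
      μ * earWeight b t u δ w + (1 - α) * (if next w = u then b - 1 else 0) := by
  have hwu : w ≠ u := fun h' => hw (h' ▸ h.mem)
  rw [earTargets, if_neg hw, Finset.sum_singleton]
  have h4 := h.dist_next w hw
  have h5 : earWeight b t u δ w = t ^ δ (next w) * t := by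
    rw [earWeight, if_neg hwu, ← h4, pow_succ]
  rw [h5]
  by_cases hnu : next w = u
  · have h6 : δ u = 0 := (h.dist_eq_zero u).2 h.mem
    simp only [hnu, h6, pow_zero, earWeight, if_true]
    linear_combination h3
  · simp only [earWeight, if_neg hnu]
    linear_combination t ^ δ (next w) * h3

/-- The weights satisfying the eigenvector equations of an ear with `m` inner vertices. -/
structure IsEarWeight (α μ b t : ℝ) (d m : ℕ) : Prop where
  nonneg : 0 ≤ α
  lt_one : α < 1
  one_lt : 1 < b
  pos : 0 < t
  ratio_lt_one : t < 1
  eq_clique : ((d : ℝ) - 1) * α + (1 - α) * (d - 2 + b) = μ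
  eq_root : ((d : ℝ) - 1) * (α * b + (1 - α)) + (α * b + (1 - α) * t ^ m) = μ * b
  eq_path : α * t + (1 - α) = μ * t

theorem IsEarWeight.term_pos {d : ℕ} (hw : IsEarWeight α μ b t d m) (w v : V) :
    0 < α * earWeight b t u δ w + (1 - α) * earWeight b t u δ v :=
  add_pos_of_nonneg_of_pos (mul_nonneg hw.nonneg (earWeight_pos hw.one_lt hw.pos w).le)
    (mul_pos (sub_pos.2 hw.lt_one) (earWeight_pos hw.one_lt hw.pos v))

theorem IsEar.le_sum (h : IsEar K u next δ m) (hw : IsEarWeight α μ b t K.card m) (w : V) :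
    μ * earWeight b t u δ w ≤
      ∑ v ∈ earTargets K u next w, (α * earWeight b t u δ w + (1 - α) * earWeight b t u δ v) := by
  have hα : 0 ≤ 1 - α := sub_nonneg.2 hw.lt_one.le
  by_cases hwK : w ∈ K
  · by_cases hwu : w = u
    · rw [hwu, h.sum_root hw.eq_root]
      have := pow_le_pow_of_le_one hw.pos.le hw.ratio_lt_one.le h.dist_le
      exact le_add_of_nonneg_right (mul_nonneg hα (sub_nonneg.2 this))
    · exact (h.sum_of_mem_ne hw.eq_clique hwK hwu).ge
  · rw [h.sum_of_notMem hw.eq_path hwK]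
    have := hw.one_lt
    exact le_add_of_nonneg_right (mul_nonneg hα (by split_ifs <;> linarith))

theorem IsEar.sum_eq (h : IsEar K u next δ m) (hw : IsEarWeight α μ b t K.card m)
    (hδ : δ (next u) = m) (hn : ∀ w ∉ K, next w ≠ u) (w : V) :
    ∑ v ∈ earTargets K u next w, (α * earWeight b t u δ w + (1 - α) * earWeight b t u δ v) =
      μ * earWeight b t u δ w := by
  by_cases hwK : w ∈ K
  · by_cases hwu : w = u
    · rw [hwu, h.sum_root hw.eq_root, hδ, sub_self, mul_zero, add_zero]
    · exact h.sum_of_mem_ne hw.eq_clique hwK hwu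
  · rw [h.sum_of_notMem hw.eq_path hwK, if_neg (hn w hwK), mul_zero, add_zero]

end Ear

/-! ### From row sums over outneighbours to bounds on the spectral radius. -/

section Matrix

variable {V : Type*} [Fintype V] {α : ℝ} {G : Digraph V}

open Classical in
/-- The set of outneighbours. -/
noncomputable def outNeighbors (G : Digraph V) (w : V) : Finset V :=
  Finset.univ.filter fun v => G.Adj w v

theorem mem_outNeighbors {w v : V} : v ∈ outNeighbors G w ↔ G.Adj w v := by
  simp [outNeighbors]

variable [DecidableEq V]

/-- Splitting α times the outdegree among the arcs makes each arc contribute its own term, so that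
adding arcs is monotone for positive vectors. -/
theorem aMatrix_mulVec (α : ℝ) (G : Digraph V) (y : V → ℝ) (w : V) :
    (aMatrix α G *ᵥ y) w = ∑ v ∈ outNeighbors G w, (α * y w + (1 - α) * y v) := by
  classical
  have h1 : (adjMatrix G *ᵥ y) w = ∑ v ∈ outNeighbors G w, y v := by
    simp [adjMatrix, Matrix.mulVec, dotProduct, outNeighbors, Finset.sum_filter]
  rw [aMatrix, add_mulVec, smul_mulVec, smul_mulVec]
  simp only [Pi.add_apply, Pi.smul_apply, smul_eq_mul, h1, mulVec_diagonal]
  rw [Finset.sum_add_distrib, Finset.sum_const, nsmul_eq_mul, ← Finset.mul_sum]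
  simp only [outDegree, outNeighbors]
  ring

theorem aMatrix_nonneg (hα0 : 0 ≤ α) (hα1 : α < 1) (i j : V) : 0 ≤ aMatrix α G i j := by
  classical
  have h : 0 ≤ 1 - α := sub_nonneg.2 hα1.le
  simp only [aMatrix, adjMatrix, Matrix.add_apply, Matrix.smul_apply, Matrix.diagonal_apply,
    Matrix.of_apply, smul_eq_mul]
  refine add_nonneg (mul_nonneg hα0 ?_) (mul_nonneg h ?_) <;> split_ifs <;> positivity

theorem aMatrix_pos (hα0 : 0 ≤ α) (hα1 : α < 1) (i j : V) (hij : G.Adj i j) :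
    0 < aMatrix α G i j := by
  classical
  have h : 0 < 1 - α := sub_pos.2 hα1
  simp only [aMatrix, adjMatrix, Matrix.add_apply, Matrix.smul_apply, Matrix.diagonal_apply,
    Matrix.of_apply, smul_eq_mul, if_pos hij, mul_one]
  refine add_pos_of_nonneg_of_pos (mul_nonneg hα0 ?_) h
  split_ifs <;> positivity

theorem aRadius_eq_realRadius (α : ℝ) (G : Digraph V) : aRadius α G = realRadius (aMatrix α G) :=
  rfl

theorem aRadius_congr {W : Type*} [Fintype W] [DecidableEq W] {H : Digraph W} (e : G.Adj ≃r H.Adj)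
    (α : ℝ) : aRadius α G = aRadius α H := by
  classical
  have h1 : ∀ u v, adjMatrix H (e u) (e v) = adjMatrix G u v := fun u v => by
    simp [adjMatrix, e.map_rel_iff]
  have h2 : ∀ u, outDegree H (e u) = outDegree G u := fun u => by
    unfold outDegree
    refine (Finset.card_equiv e.toEquiv fun v => ?_).symm
    simp only [Finset.mem_filter, Finset.mem_univ, true_and]
    exact e.map_rel_iff.symm
  have h3 : (aMatrix α H).map (fun x : ℝ => (x : ℂ)) =
      Matrix.reindexAlgEquiv ℂ ℂ e.toEquiv ((aMatrix α G).map (fun x : ℝ => (x : ℂ))) := by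
    ext i j
    obtain ⟨u, rfl⟩ := e.surjective i
    obtain ⟨v, rfl⟩ := e.surjective j
    have : e.toEquiv.symm (e u) = u := e.toEquiv.symm_apply_apply u
    have : e.toEquiv.symm (e v) = v := e.toEquiv.symm_apply_apply v
    simp [aMatrix, Matrix.diagonal_apply, *]
  unfold aRadius spectralRadius
  rw [h3, AlgEquiv.spectrum_eq]

variable {K : Finset V} {u : V} {next : V → V} {δ : V → ℕ} {m : ℕ} {μ b t : ℝ}

theorem IsEar.aRadius_le (h : IsEar K u next δ m) (hw : IsEarWeight α μ b t K.card m)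
    (hμ : 0 ≤ μ) (hδ : δ (next u) = m) (hn : ∀ w ∉ K, next w ≠ u)
    (hG : ∀ w, outNeighbors G w ⊆ earTargets K u next w) : aRadius α G ≤ μ := by
  rw [aRadius_eq_realRadius]
  refine realRadius_le (aMatrix_nonneg hw.nonneg hw.lt_one)
    (earWeight_pos (u := u) (δ := δ) hw.one_lt hw.pos) hμ fun w => ?_
  rw [aMatrix_mulVec, ← h.sum_eq hw hδ hn]
  exact Finset.sum_le_sum_of_subset_of_nonneg (hG w) fun v _ _ => (hw.term_pos w v).le

theorem IsEar.le_mulVec (h : IsEar K u next δ m) (hw : IsEarWeight α μ b t K.card m)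
    (hG : ∀ w, earTargets K u next w ⊆ outNeighbors G w) (w : V) :
    μ * earWeight b t u δ w ≤ (aMatrix α G *ᵥ earWeight b t u δ) w := by
  rw [aMatrix_mulVec]
  exact (h.le_sum hw w).trans
    (Finset.sum_le_sum_of_subset_of_nonneg (hG w) fun v _ _ => (hw.term_pos w v).le)

theorem IsEar.le_aRadius (h : IsEar K u next δ m) (hw : IsEarWeight α μ b t K.card m)
    (hμ : 0 ≤ μ) (hG : ∀ w, earTargets K u next w ⊆ outNeighbors G w) : μ ≤ aRadius α G := by
  have : Nonempty V := ⟨u⟩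
  exact le_realRadius (aMatrix_nonneg hw.nonneg hw.lt_one)
    (earWeight_pos hw.one_lt hw.pos) hμ (h.le_mulVec hw hG)

theorem IsEar.eq_of_aRadius_le (h : IsEar K u next δ m) (hw : IsEarWeight α μ b t K.card m)
    (hμ : 0 ≤ μ) (hG : ∀ w, earTargets K u next w ⊆ outNeighbors G w)
    (hconn : IsStronglyConnected G) (hle : aRadius α G ≤ μ) :
    (∀ w, outNeighbors G w = earTargets K u next w) ∧ δ (next u) = m ∧ ∀ w ∉ K, next w ≠ u := by
  have hα : 0 < 1 - α := sub_pos.2 hw.lt_one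
  have heq : ∀ w, (aMatrix α G *ᵥ earWeight b t u δ) w ≤ μ * earWeight b t u δ w := fun w => by
    by_contra! hlt
    exact hle.not_gt (lt_realRadius (aMatrix_nonneg hw.nonneg hw.lt_one)
      (aMatrix_pos hw.nonneg hw.lt_one) hconn (earWeight_pos hw.one_lt hw.pos) hμ
      (h.le_mulVec hw hG) hlt)
  simp only [aMatrix_mulVec] at heq
  have hsum : ∀ w, ∑ v ∈ earTargets K u next w,
      (α * earWeight b t u δ w + (1 - α) * earWeight b t u δ v) ≤ μ * earWeight b t u δ w :=
    fun w => (Finset.sum_le_sum_of_subset_of_nonneg (hG w)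
      fun v _ _ => (hw.term_pos w v).le).trans (heq w)
  refine ⟨fun w => ?_, ?_, fun w hwK hwu => ?_⟩
  · by_contra hne
    obtain ⟨v, hv1, hv2⟩ := Finset.exists_of_ssubset ((hG w).ssubset_of_ne (Ne.symm hne))
    have := Finset.sum_lt_sum_of_subset (hG w) hv1 hv2 (hw.term_pos (u := u) (δ := δ) w v)
      fun v _ _ => (hw.term_pos w v).le
    linarith [heq w, h.le_sum hw w]
  · have h1 := hsum u
    rw [h.sum_root hw.eq_root] at h1
    by_contra hne
    have := pow_lt_pow_right_of_lt_one₀ hw.pos hw.ratio_lt_one (lt_of_le_of_ne h.dist_le hne)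
    nlinarith
  · have h1 := hsum w
    rw [h.sum_of_notMem hw.eq_path hwK, if_pos hwu] at h1
    nlinarith [hw.one_lt]

end Matrix

end AAlpha

namespace AAlpha

/-! ### Distances to the clique, and the choice of an ear. -/

section Distance

variable {V : Type*}

/-- In a strongly connected digraph, the distance to a nonempty set together with a choice of
first arcs of shortest walks. -/
theorem exists_dist {G : Digraph V} (hconn : IsStronglyConnected G) {K : Finset V} {u : V}
    (hu : u ∈ K) : ∃ (next : V → V) (δ : V → ℕ), (∀ w, δ w = 0 ↔ w ∈ K) ∧
      ∀ w ∉ K, G.Adj w (next w) ∧ δ (next w) + 1 = δ w := by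
  classical
  -- `P k w` asserts a walk of exactly k arcs from w into K; the least such k is the distance.
  let P : ℕ → V → Prop :=
    Nat.rec (motive := fun _ => V → Prop) (fun w => w ∈ K) fun _ Q w => ∃ v, G.Adj w v ∧ Q v
  have hP : ∀ w, ∃ k, P k w := fun w => by
    induction hconn w u using Relation.ReflTransGen.head_induction_on with
    | refl => exact ⟨0, hu⟩
    | @head a c hac _ ih =>
      obtain ⟨k, hk⟩ := ih
      exact ⟨k + 1, c, hac, hk⟩
  have h0 : ∀ w, Nat.find (hP w) = 0 ↔ w ∈ K := fun w => Nat.find_eq_zero (hP w)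
  have hex : ∀ w, ∃ v, w ∉ K → G.Adj w v ∧ Nat.find (hP v) + 1 = Nat.find (hP w) := fun w => by
    by_cases hw : w ∈ K
    · exact ⟨w, fun h => absurd hw h⟩
    · obtain ⟨k, hk⟩ := Nat.exists_eq_succ_of_ne_zero fun h => hw ((h0 w).1 h)
      have hs := Nat.find_spec (hP w)
      rw [hk] at hs
      obtain ⟨v, hv1, hv2⟩ := hs
      refine ⟨v, fun _ => ⟨hv1, le_antisymm ?_ ?_⟩⟩
      · rw [hk]
        exact Nat.succ_le_succ (Nat.find_min' (hP v) hv2)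
      · exact Nat.find_min' (hP w) ⟨v, hv1, Nat.find_spec (hP v)⟩
  choose next hnext using hex
  exact ⟨next, fun w => Nat.find (hP w), h0, hnext⟩

theorem exists_dist_eq {K : Finset V} {next : V → V} {δ : V → ℕ} (h0 : ∀ w, δ w = 0 ↔ w ∈ K)
    (hn : ∀ w ∉ K, δ (next w) + 1 = δ w) {j : ℕ} (hj : j ≠ 0) (w : V) (hw : j ≤ δ w) :
    ∃ v ∉ K, δ v = j := by
  induction hk : δ w generalizing w with
  | zero => omega
  | succ k ih =>
    have hwK : w ∉ K := fun h => by rw [(h0 w).2 h] at hk; omega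
    rcases hw.eq_or_lt with h | h
    · exact ⟨w, hwK, h.symm⟩
    · have := hn w hwK
      exact ih (next w) (by omega) (by omega)

variable [Fintype V] [DecidableEq V]

theorem Icc_subset_image_dist {K : Finset V} {next : V → V} {δ : V → ℕ}
    (h0 : ∀ w, δ w = 0 ↔ w ∈ K) (hn : ∀ w ∉ K, δ (next w) + 1 = δ w) (w : V) :
    Finset.Icc 1 (δ w) ⊆ Kᶜ.image δ := fun j hj => by
  obtain ⟨h1, h2⟩ := Finset.mem_Icc.1 hj
  obtain ⟨v, hv, rfl⟩ := exists_dist_eq h0 hn (by omega) w h2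
  exact Finset.mem_image_of_mem _ (Finset.mem_compl.2 hv)

theorem dist_le_card_compl {K : Finset V} {next : V → V} {δ : V → ℕ}
    (h0 : ∀ w, δ w = 0 ↔ w ∈ K) (hn : ∀ w ∉ K, δ (next w) + 1 = δ w) (w : V) :
    δ w ≤ Kᶜ.card := by
  simpa using (Finset.card_le_card (Icc_subset_image_dist h0 hn w)).trans Finset.card_image_le

/-- All values 1, …, |Kᶜ| are taken along the walk from w, so pigeonhole leaves no repetition. -/
theorem dist_injOn {K : Finset V} {next : V → V} {δ : V → ℕ}
    (h0 : ∀ w, δ w = 0 ↔ w ∈ K) (hn : ∀ w ∉ K, δ (next w) + 1 = δ w) {w : V}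
    (hw : δ w = Kᶜ.card) : Set.InjOn δ (Kᶜ : Finset V) := by
  refine Finset.card_image_iff.1 (le_antisymm Finset.card_image_le ?_)
  simpa [hw] using Finset.card_le_card (Icc_subset_image_dist h0 hn w)

theorem exists_arc_leaving {G : Digraph V} (hconn : IsStronglyConnected G) {K : Finset V}
    (hK : K.Nonempty) (hK' : K ≠ Finset.univ) : ∃ u ∈ K, ∃ w ∉ K, G.Adj u w := by
  obtain ⟨a, ha⟩ := hK
  obtain ⟨c, hc⟩ : ∃ c, c ∉ K := by
    by_contra! h
    exact hK' (Finset.eq_univ_iff_forall.2 h)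
  by_contra! h
  refine hc ?_
  induction hconn a c with
  | refl => exact ha
  | tail _ hbc ih => exact by_contra fun hcK => h _ (by_contra fun h' => h' (ih h')) _ hcK hbc

omit [DecidableEq V] in
theorem exists_clique_card_eq (G : Digraph V) :
    ∃ S : Finset V, IsClique G S ∧ S.card = cliqueNumber G :=
  Nat.sSup_mem (s := {k | ∃ S : Finset V, IsClique G S ∧ S.card = k})
    ⟨0, ∅, by simp [IsClique], rfl⟩
    ⟨Fintype.card V, by rintro _ ⟨S, -, rfl⟩; exact S.card_le_univ⟩

omit [Fintype V] in
theorem exists_enumeration {S : Finset V} {e : V} (he : e ∈ S) :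
    ∃ c : V → ℕ, Set.InjOn c S ∧ c e = 0 ∧ ∀ v ∈ S, c v < S.card := by
  have hpos : 0 < S.card := Finset.card_pos.2 ⟨e, he⟩
  let σ := S.equivFin.trans (Equiv.swap (S.equivFin ⟨e, he⟩) ⟨0, hpos⟩)
  refine ⟨fun v => if h : v ∈ S then (σ ⟨v, h⟩ : ℕ) else 0, fun v hv w hw h => ?_, ?_, ?_⟩
  · have hv' : v ∈ S := hv
    have hw' : w ∈ S := hw
    simp only [dif_pos hv', dif_pos hw'] at h
    exact congrArg Subtype.val (σ.injective (Fin.ext h))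
  · simp [he, σ]
  · intro v hv
    simp only [dif_pos hv]
    exact Fin.is_lt _

end Distance

/-! ### Recognising B_{n,d} in the extremal case. -/

section Iso

variable {V : Type*} [Fintype V] [DecidableEq V] {K : Finset V} {u : V} {next : V → V}
  {δ : V → ℕ} {m d n : ℕ} {G : Digraph V}

omit [Fintype V] in
theorem mem_earTargets {w v : V} : v ∈ earTargets K u next w ↔
    (w ∉ K ∧ v = next w) ∨ (w ∈ K ∧ v ∈ K ∧ v ≠ w) ∨ (w = u ∧ u ∈ K ∧ v = next u) := by
  unfold earTargets
  split_ifs with h1 h2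
  · subst h2; simp [h1]; tauto
  · simp [h1, h2]; tauto
  · have : ¬ (w = u ∧ u ∈ K ∧ v = next u) := fun h => h1 (h.1 ▸ h.2.1)
    simp [h1, this]

theorem IsEar.nonempty_iso (h : IsEar K u next δ m) (hcard : Fintype.card V = n)
    (hK : K.card = d) (hm : m + d = n) (hδ : δ (next u) = m) (hn : ∀ w ∉ K, next w ≠ u)
    (hG : ∀ w v, G.Adj w v ↔ v ∈ earTargets K u next w) :
    Nonempty (G.Adj ≃r (digraphB n d).Adj) := by
  have hcompl : Kᶜ.card = m := by rw [Finset.card_compl]; omega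
  have hinj : Set.InjOn δ (Kᶜ : Finset V) :=
    dist_injOn h.dist_eq_zero h.dist_next (hδ.trans hcompl.symm)
  have hinj' : ∀ v w, v ∉ K → w ∉ K → δ v = δ w → v = w := fun v w hv hw hvw =>
    hinj (Finset.mem_coe.2 (Finset.mem_compl.2 hv)) (Finset.mem_coe.2 (Finset.mem_compl.2 hw)) hvw
  have hle : ∀ w, δ w ≤ m := fun w => hcompl ▸ dist_le_card_compl h.dist_eq_zero h.dist_next w
  have hpos : ∀ w ∉ K, 0 < δ w := fun w hw =>
    Nat.pos_of_ne_zero fun h' => hw ((h.dist_eq_zero w).1 h')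
  have hm0 : 0 < m := hδ ▸ hpos _ h.next_notMem
  -- z is the last inner vertex of the ear. Its successor in K must receive the number m + 1, so the
  -- enumeration of K without u starts there.
  obtain ⟨z, hzK, hz⟩ := exists_dist_eq h.dist_eq_zero h.dist_next one_ne_zero (next u)
    (by omega)
  have hezK : next z ∈ K := (h.dist_eq_zero _).1 (by have := h.dist_next z hzK; omega)
  obtain ⟨c, hc1, hc2, hc3⟩ := exists_enumeration (Finset.mem_erase.2 ⟨hn z hzK, hezK⟩)
  rw [Finset.card_erase_of_mem h.mem, hK] at hc3
  have hc1' : ∀ v w, v ∈ K → v ≠ u → w ∈ K → w ≠ u → c v = c w → v = w :=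
    fun v w hv hv' hw hw' hvw => hc1 (Finset.mem_coe.2 (Finset.mem_erase.2 ⟨hv', hv⟩))
      (Finset.mem_coe.2 (Finset.mem_erase.2 ⟨hw', hw⟩)) hvw
  have hc3' : ∀ v, v ∈ K → v ≠ u → c v < d - 1 := fun v hv hv' =>
    hc3 v (Finset.mem_erase.2 ⟨hv', hv⟩)
  have hd : 0 < d := hK ▸ Finset.card_pos.2 ⟨u, h.mem⟩
  -- Zero-based numbering: u first, then the ear by decreasing distance at 1, …, m, then the rest of
  -- K from m + 1 on.
  let φ : V → ℕ := fun w => if w ∈ K then if w = u then 0 else m + 1 + c w else m + 1 - δ w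
  have φu : φ u = 0 := by simp [φ, h.mem]
  have φK : ∀ w, w ∈ K → w ≠ u → φ w = m + 1 + c w := fun w hw hw' => by simp [φ, hw, hw']
  have φo : ∀ w, w ∉ K → φ w = m + 1 - δ w := fun w hw => by simp [φ, hw]
  have hcases : ∀ w, w ∉ K ∨ w = u ∨ (w ∈ K ∧ w ≠ u) := fun w => by tauto
  have φlt : ∀ w, φ w < n := fun w => by
    rcases hcases w with hw | rfl | ⟨hw, hw'⟩
    · have := hpos w hw
      rw [φo w hw]; omega
    · rw [φu]; omega
    · have := hc3' w hw hw'
      rw [φK w hw hw']; omega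
  have φinj : ∀ v w, φ v = φ w → v = w := fun v w hvw => by
    rcases hcases w with hw | rfl | ⟨hw, hw'⟩ <;> rcases hcases v with hv | rfl | ⟨hv, hv'⟩
    · rw [φo v hv, φo w hw] at hvw
      have := hle v
      have := hle w
      exact hinj' v w hv hw (by omega)
    · rw [φu, φo w hw] at hvw
      have := hle w
      omega
    · rw [φK v hv hv', φo w hw] at hvw
      have := hpos w hw
      omega
    · rw [φu, φo v hv] at hvw
      have := hle v
      omega
    · rfl
    · rw [φu, φK v hv hv'] at hvw
      omega
    · rw [φK w hw hw', φo v hv] at hvw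
      have := hpos v hv
      omega
    · rw [φu, φK w hw hw'] at hvw
      omega
    · rw [φK v hv hv', φK w hw hw'] at hvw
      exact hc1' v w hv hv' hw hw' (by omega)
  have φnext : ∀ w ∉ K, φ (next w) = φ w + 1 := fun w hw => by
    have h1 := h.dist_next w hw
    rw [φo w hw]
    by_cases hw' : next w ∈ K
    · have h2 := (h.dist_eq_zero _).2 hw'
      obtain rfl := hinj' w z hw hzK (by omega)
      rw [φK _ hw' (hn w hw), hc2]
      omega
    · rw [φo _ hw']
      have := hle w
      omega
  have φnextu : φ (next u) = 1 := by rw [φo _ h.next_notMem]; omega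
  have φmem : ∀ v, (φ v = 0 ∨ m + 1 ≤ φ v) ↔ v ∈ K := fun v => by
    rcases hcases v with hv | rfl | ⟨hv, hv'⟩
    · have := hpos v hv
      have := hle v
      rw [φo v hv]
      exact iff_of_false (by omega) hv
    · simp [φu, h.mem]
    · rw [φK v hv hv']
      exact iff_of_true (by omega) hv
  have hφ : Function.Bijective fun w => (⟨φ w, φlt w⟩ : Fin n) :=
    (Fintype.bijective_iff_injective_and_card _).2
      ⟨fun v w hvw => φinj v w (Fin.mk.inj_iff.1 hvw), by simp [hcard]⟩
  refine ⟨⟨Equiv.ofBijective _ hφ, fun {w v} => ?_⟩⟩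
  rw [hG, mem_earTargets]
  have hB : ∀ i, n + 1 ≤ i + d ↔ m + 1 ≤ i := fun i => by omega
  have hB' : ∀ i, i + d ≤ n + 1 ↔ i ≤ m + 1 := fun i => by omega
  simp only [digraphB, Equiv.ofBijective_apply, ne_eq, Fin.mk.injEq, hB, hB', φmem]
  constructor
  · rintro (⟨h1, h2, h3⟩ | ⟨h1, h2⟩)
    · exact Or.inr (Or.inl ⟨h2, h3, fun h' => h1 (by rw [h'])⟩)
    · rcases hcases w with hw | rfl | ⟨hw, hw'⟩
      · exact Or.inl ⟨hw, φinj _ _ (by rw [φnext w hw, h1])⟩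
      · exact Or.inr (Or.inr ⟨rfl, h.mem, φinj _ _ (by rw [φnextu, ← h1, φu])⟩)
      · rw [φK w hw hw'] at h1
        omega
  · rintro (⟨hw, rfl⟩ | ⟨h1, h2, h3⟩ | ⟨rfl, -, rfl⟩)
    · refine Or.inr ⟨(φnext w hw).symm, ?_⟩
      rw [φnext w hw, φo w hw]
      have := hpos w hw
      omega
    · exact Or.inl ⟨fun h' => h3 (φinj _ _ h').symm, h1, h2⟩
    · exact Or.inr (by rw [φnextu, φu]; omega)

end Iso

/-- The digraph `B_{n,d}` has the weights of an ear as an eigenvector. -/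
theorem aRadius_digraphB_le {n d : ℕ} (hd : 2 ≤ d) (hdn : d + 1 ≤ n) {α μ b t : ℝ}
    (hw : IsEarWeight α μ b t d (n - d)) (hμ : 0 ≤ μ) : aRadius α (digraphB n d) ≤ μ := by
  let K : Finset (Fin n) := Finset.univ.filter fun i => i.val = 0 ∨ n + 1 ≤ i.val + d
  let u : Fin n := ⟨0, by omega⟩
  -- The default at the last vertex is harmless: that vertex is in K and is not u.
  let next : Fin n → Fin n := fun i => if h : i.val + 1 < n then ⟨i.val + 1, h⟩ else i
  -- Truncated subtraction gives 0 on the clique vertices at the end; only vertex 0 needs a separate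
  -- case.
  let δ : Fin n → ℕ := fun i => if i.val = 0 then 0 else n + 1 - d - i.val
  have hmem : ∀ i, i ∈ K ↔ (i.val = 0 ∨ n + 1 ≤ i.val + d) := fun i => by simp [K]
  have hnext : ∀ i : Fin n, i.val + 1 < n → (next i).val = i.val + 1 := fun i hi => by
    simp [next, hi]
  have hcard : K.card = d := by
    have h1 : Kᶜ.card = n - d := by
      have : Kᶜ.map Fin.valEmbedding = Finset.Icc 1 (n - d) := by
        ext j
        simp only [Finset.mem_map, Finset.mem_compl, hmem, Fin.valEmbedding_apply, Finset.mem_Icc]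
        constructor
        · rintro ⟨i, hi, rfl⟩
          omega
        · intro hj
          exact ⟨⟨j, by omega⟩, by simp only; omega, rfl⟩
      rw [← Finset.card_map Fin.valEmbedding, this]
      simp
    have h2 := Finset.card_add_card_compl K
    rw [Fintype.card_fin] at h2
    omega
  have hu : (next u).val = 1 := hnext u (by simp only [u]; omega)
  have hδu : δ (next u) = n - d := by
    simp only [δ, hu]
    rw [if_neg one_ne_zero]
    omega
  have hear : IsEar K u next δ (n - d) := by
    refine ⟨by simp [hmem, u], ?_, fun i => ?_, fun i hi => ?_, hδu.le⟩
    · rw [hmem, hu]; omega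
    · rw [hmem]
      simp only [δ]
      split_ifs <;> omega
    · rw [hmem] at hi
      have := hnext i (by omega)
      simp only [δ, this]
      rw [if_neg (by omega), if_neg (by omega)]
      omega
  have hw' : IsEarWeight α μ b t K.card (n - d) := by rwa [hcard]
  refine hear.aRadius_le hw' hμ hδu (fun i hi h => ?_) fun i j hj => ?_
  · rw [hmem] at hi
    have := hnext i (by omega)
    rw [h] at this
    simp [u] at this
  · rw [mem_outNeighbors] at hj
    rw [mem_earTargets]
    rcases hj with ⟨h1, h2, h3⟩ | ⟨h1, h2⟩
    · exact Or.inr (Or.inl ⟨(hmem i).2 h2, (hmem j).2 h3, h1.symm⟩)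
    · have h3 : j = next i := Fin.ext (by rw [hnext i (by omega), h1])
      by_cases hi : i.val = 0
      · have : i = u := Fin.ext hi
        exact Or.inr (Or.inr ⟨this, hear.mem, this ▸ h3⟩)
      · exact Or.inl ⟨by rw [hmem]; omega, h3⟩

end AAlpha

theorem mainTheorem4 {V : Type*} [Fintype V] [DecidableEq V] (n d : ℕ) (α : ℝ)
    (hα0 : 0 ≤ α) (hα1 : α < 1) (hd : 2 ≤ d) (hdn : d + 1 ≤ n)
    (G : Digraph V) (hcard : Fintype.card V = n)
    (hsimple : AAlpha.IsSimple G) (hconn : AAlpha.IsStronglyConnected G)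
    (hclique : AAlpha.cliqueNumber G = d) :
    AAlpha.aRadius α (AAlpha.digraphB n d) ≤ AAlpha.aRadius α G ∧
      (AAlpha.aRadius α G = AAlpha.aRadius α (AAlpha.digraphB n d) ↔
        Nonempty (G.Adj ≃r (AAlpha.digraphB n d).Adj)) := by
  open AAlpha in
  obtain ⟨μ, b, t, hμ, hb, ht0, ht1, e1, e2, e3⟩ := exists_weights hα0 hα1 hd (n - d)
  have hw : IsEarWeight α μ b t d (n - d) := ⟨hα0, hα1, hb, ht0, ht1, e1, e2, e3⟩
  have hB := aRadius_digraphB_le hd hdn hw hμ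
  obtain ⟨K, hK, hKcard⟩ := exists_clique_card_eq G
  rw [hclique] at hKcard
  obtain ⟨u, hu, w₀, hw₀, huw⟩ := exists_arc_leaving hconn
    (Finset.card_pos.1 (by omega : 0 < K.card))
    (fun h => by rw [h, Finset.card_univ] at hKcard; omega)
  obtain ⟨nx, δ, h0, hnx⟩ := exists_dist hconn hu
  -- `nx` is constrained only outside K, so its value at u can be replaced by the head of the
  -- leaving arc.
  let next : V → V := Function.update nx u w₀
  have hnu : next u = w₀ := Function.update_self ..
  have hno : ∀ w ∉ K, next w = nx w := fun w hw =>
    Function.update_of_ne (fun h : w = u => hw (h ▸ hu)) ..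
  have hdist : ∀ w ∉ K, δ (next w) + 1 = δ w := fun w hw => by rw [hno w hw, (hnx w hw).2]
  have hear : IsEar K u next δ (n - d) := by
    refine ⟨hu, hnu.symm ▸ hw₀, h0, hdist, ?_⟩
    have := dist_le_card_compl h0 hdist (next u)
    rwa [Finset.card_compl, hcard, hKcard] at this
  have hG : ∀ w, earTargets K u next w ⊆ outNeighbors G w := fun w v hv => by
    rw [mem_outNeighbors]
    rcases mem_earTargets.1 hv with ⟨h1, rfl⟩ | ⟨h1, h2, h3⟩ | ⟨rfl, -, rfl⟩
    · rw [hno w h1]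
      exact (hnx w h1).1
    · exact hK h1 h2 h3.symm
    · rwa [hnu]
  have hw' : IsEarWeight α μ b t K.card (n - d) := by rwa [hKcard]
  have hle := hear.le_aRadius hw' hμ hG
  refine ⟨hB.trans hle, fun heq => ?_, fun ⟨e⟩ => aRadius_congr e α⟩
  obtain ⟨h1, h2, h3⟩ := hear.eq_of_aRadius_le hw' hμ hG hconn (heq.trans_le hB)
  exact hear.nonempty_iso hcard hKcard (by omega) h2 h3 fun w v => by
    rw [← h1, mem_outNeighbors]
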